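/- For a graph $G$, let $\mathcal N(K_s,G)$ be the number of copies of $K_s$ in $G$ (subgraphs of $G$ isomorphic to $K_s$). Let $T_k(m)$ be the Turán graph, i.e. the complete $k$-partite graph on $m$ vertices whose part sizes differ by at most one, and let $G_1\vee G_2$ be the join of $G_1$ and $G_2$, i.e. their disjoint union together with all edges between $V(G_1)$ and $V(G_2)$. Theorem. Let $r\ge 3$. There is an integer $n_0=n_0(r)$ such that for all $n\ge n_0$, the maximum of $\mathcal N(K_r,G)$ over all $n$-vertex graphs $G$ that do not contain two vertex-disjoint copies of $K_r$ equals $$\mathcal N\bigl(K_{r-1},\,T_{r-1}(n-1)\bigr),$$ and, up to isomorphism, $K_1\vee T_{r-1}(n-1)$ is the unique $n$-vertex graph without two vertex-disjoint copies of $K_r$ that attains this maximum. -/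

import Mathlib

open SimpleGraph

/-- The join `G ∨ H`: the disjoint union of `G` and `H` together with all edges between them. -/
def graphJoin {V W : Type*} (G : SimpleGraph V) (H : SimpleGraph W) : SimpleGraph (V ⊕ W) :=
  (G ⊕g H) ⊔ completeBipartiteGraph V W

/-- The disjoint union of two copies of the complete graph on `r` vertices. -/
def twoDisjointCliques (r : ℕ) : SimpleGraph (Fin r ⊕ Fin r) :=
  completeGraph (Fin r) ⊕g completeGraph (Fin r)

open scoped Classical in
/-- The generalized Turán number `ex(n, T, F)`: the maximum number of (unlabelled, not necessarily
induced) copies of `T` in an `F`-free graph on `n` vertices. -/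
noncomputable def generalizedTuranNumber {U W : Type*} (n : ℕ) (T : SimpleGraph U)
    (F : SimpleGraph W) : ℕ :=
  Finset.sup {G : SimpleGraph (Fin n) | F.Free G} (fun G => G.copyCount T)

/-! A graph has no two disjoint `r`-cliques exactly when its `r`-cliques form an intersecting family
(`twoDisjointCliques_free_iff`). Put `s = r - 1`.

If these cliques have no common vertex, there are at most `r² n^(r-2)` of them
(`card_le_of_intersecting`). The Turán graph has order `n^(r-1)` many `s`-cliques
(`mul_pow_lt_card_cliquesIn_turanGraph`), so this case loses for large `n`.

If they share a vertex `v`, deleting `v` maps them injectively to `s`-cliques of `G - v`, which has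
no `(s+1)`-clique, and Zykov's theorem (`card_cliquesIn_le_turanGraph`) bounds their number.
Equality makes `G - v` a Turán graph all of whose `s`-cliques extend by `v`; as they cover its
vertices, `v` is adjacent to everything (`card_cliquesIn_le_of_forall_mem`).

Zykov's theorem itself comes from degree majorisation: the clique count is at most a product of `s`
class sizes (`exists_coloring_card_cliquesIn_le`), and such a product is largest when the classes
are balanced. -/

/-! ### Clique counts and products of class sizes. -/

section CliquesIn

variable {V : Type*} {G : SimpleGraph V} {s : ℕ} {W : Finset V}

open scoped Classical in
/-- The `s`-cliques of `G` all of whose vertices lie in `W`. -/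
noncomputable def cliquesIn (G : SimpleGraph V) (s : ℕ) (W : Finset V) : Finset (Finset V) :=
  {t ∈ W.powerset | G.IsNClique s t}

lemma mem_cliquesIn {t : Finset V} : t ∈ cliquesIn G s W ↔ t ⊆ W ∧ G.IsNClique s t := by
  simp [cliquesIn]

/-- The product of the sizes of the first `s` colour classes of `c` in `W`. -/
def classProd (c : V → ℕ) (s : ℕ) (W : Finset V) : ℕ :=
  ∏ i ∈ Finset.range s, (W.filter (fun v => c v = i)).card

lemma image_mem_cliquesIn [DecidableEq V] {c : V → ℕ} (hc : ∀ x ∈ W, ∀ y ∈ W, c x ≠ c y → G.Adj x y)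
    {f : Fin s → V} (hf : ∀ i, f i ∈ W ∧ c (f i) = i) :
    Finset.univ.image f ∈ cliquesIn G s W := by
  have hinj : Function.Injective f := fun i j h => by
    have := (hf i).2.symm.trans ((congrArg c h).trans (hf j).2)
    exact Fin.ext this
  rw [mem_cliquesIn, isNClique_iff]
  refine ⟨?_, ?_, ?_⟩
  · intro x hx
    obtain ⟨i, -, rfl⟩ := Finset.mem_image.1 hx
    exact (hf i).1
  · intro x hx y hy hxy
    simp only [Finset.coe_image, Finset.coe_univ, Set.image_univ, Set.mem_range] at hx hy
    obtain ⟨i, rfl⟩ := hx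
    obtain ⟨j, rfl⟩ := hy
    refine hc _ (hf i).1 _ (hf j).1 fun h => hxy ?_
    rw [(hf i).2, (hf j).2] at h
    rw [Fin.ext h]
  · rw [Finset.card_image_of_injective _ hinj, Finset.card_univ, Fintype.card_fin]

/-- Choosing one vertex from each class gives a clique, and the colours recover the choice from the
clique. -/
lemma classProd_le_card_cliquesIn {c : V → ℕ}
    (hc : ∀ x ∈ W, ∀ y ∈ W, c x ≠ c y → G.Adj x y) :
    classProd c s W ≤ (cliquesIn G s W).card := by
  classical
  rw [classProd, Finset.prod_range, ← Fintype.card_piFinset]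
  refine Finset.card_le_card_of_injOn (fun f => Finset.univ.image f) ?_ ?_
  · intro f hf
    refine image_mem_cliquesIn hc fun i => ?_
    simpa using Fintype.mem_piFinset.1 (Finset.mem_coe.1 hf) i
  · intro f hf g hg hfg
    have hf' : ∀ i, c (f i) = i := fun i => by
      have := Fintype.mem_piFinset.1 (Finset.mem_coe.1 hf) i
      exact (Finset.mem_filter.1 this).2
    have hg' : ∀ i, c (g i) = i := fun i => by
      have := Fintype.mem_piFinset.1 (Finset.mem_coe.1 hg) i
      exact (Finset.mem_filter.1 this).2
    funext i
    have hi : f i ∈ Finset.univ.image g := by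
      rw [← show Finset.univ.image f = Finset.univ.image g from hfg]
      exact Finset.mem_image_of_mem _ (Finset.mem_univ i)
    obtain ⟨j, -, hj⟩ := Finset.mem_image.1 hi
    have : j = i := Fin.ext (by rw [← hg' j, hj, hf' i])
    rw [← hj, this]

/-- If all colour classes of a complete multipartite graph are nonempty, then every vertex lies in
a clique meeting all of them. -/
lemma exists_mem_cliquesIn {c : V → ℕ} (hc : ∀ x ∈ W, ∀ y ∈ W, c x ≠ c y → G.Adj x y)
    (hpos : ∀ i < s, ∃ x ∈ W, c x = i) {w : V} (hw : w ∈ W) (hws : c w < s) :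
    ∃ t ∈ cliquesIn G s W, w ∈ t := by
  classical
  choose g hg using fun i : Fin s => hpos i i.2
  refine ⟨_, image_mem_cliquesIn hc (f := fun i => if (i : ℕ) = c w then w else g i) ?_, ?_⟩
  · intro i
    split_ifs with h
    · exact ⟨hw, h.symm⟩
    · exact hg i
  · exact Finset.mem_image.2 ⟨⟨c w, hws⟩, Finset.mem_univ _, by simp⟩

lemma exists_of_classProd_ne_zero {c : V → ℕ} (h : classProd c s W ≠ 0) :
    ∀ i < s, ∃ x ∈ W, c x = i := by
  intro i hi
  have := Finset.prod_ne_zero_iff.1 h i (Finset.mem_range.2 hi)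
  obtain ⟨x, hx⟩ := Finset.card_pos.1 (Nat.pos_of_ne_zero this)
  exact ⟨x, (Finset.mem_filter.1 hx).1, (Finset.mem_filter.1 hx).2⟩

/-- A set containing no `(s + 1)`-clique can be coloured with `s` colours so that the number of
`s`-cliques is at most the product of the sizes of the colour classes; when equality holds and the
product is nonzero, the colour classes are the parts of a complete multipartite graph. -/
theorem exists_coloring_card_cliquesIn_le (G : SimpleGraph V) (s : ℕ) :
    ∀ W : Finset V, cliquesIn G (s + 1) W = ∅ →
      ∃ c : V → ℕ, (∀ v ∈ W, c v < s) ∧ (cliquesIn G s W).card ≤ classProd c s W ∧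
        ((cliquesIn G s W).card = classProd c s W → classProd c s W ≠ 0 →
          ∀ x ∈ W, ∀ y ∈ W, G.Adj x y ↔ c x ≠ c y) := by
  classical
  induction s with
  | zero =>
    intro W hW
    have hW' : W = ∅ := by
      by_contra hne
      obtain ⟨x, hx⟩ := Finset.nonempty_iff_ne_empty.2 hne
      have : {x} ∈ cliquesIn G 1 W := by
        rw [mem_cliquesIn]
        exact ⟨by simpa using hx, by simp⟩
      rw [show (0 + 1) = 1 from rfl] at hW
      rw [hW] at this
      simp at this
    subst hW'
    refine ⟨fun _ => 0, by simp, ?_, by simp⟩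
    rw [classProd, Finset.range_zero, Finset.prod_empty]
    refine Finset.card_le_one.2 fun a ha b hb => ?_
    rw [mem_cliquesIn] at ha hb
    rw [Finset.subset_empty.1 ha.1, Finset.subset_empty.1 hb.1]
  | succ s ih =>
    intro W hW
    rcases W.eq_empty_or_nonempty with rfl | hne
    · refine ⟨fun _ => 0, by simp, ?_, by simp⟩
      have : cliquesIn G (s + 1) ∅ = ∅ := by
        refine Finset.eq_empty_of_forall_notMem fun t ht => ?_
        rw [mem_cliquesIn] at ht
        have := ht.2.card_eq
        rw [Finset.subset_empty.1 ht.1] at this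
        simp at this
      rw [this]
      simp
    set C := cliquesIn G (s + 1) W with hC
    -- Take `v` in the most `(s+1)`-cliques. Its neighbours are coloured by induction, and its
    -- non-neighbours, `v` included, form the new class.
    obtain ⟨v, hvW, hmax⟩ := W.exists_max_image (fun u => {t ∈ C | u ∈ t}.card) hne
    set N := W.filter (fun x => G.Adj v x) with hN
    set A := W.filter (fun x => ¬ G.Adj v x) with hA
    have hNfree : cliquesIn G (s + 1) N = ∅ := by
      refine Finset.eq_empty_of_forall_notMem fun t ht => ?_
      rw [mem_cliquesIn] at ht
      have hin : insert v t ∈ cliquesIn G (s + 1 + 1) W := by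
        rw [mem_cliquesIn]
        refine ⟨Finset.insert_subset hvW (ht.1.trans (Finset.filter_subset _ _)),
          ht.2.insert fun b hb => (Finset.mem_filter.1 (ht.1 hb)).2⟩
      rw [hW] at hin
      simp at hin
    obtain ⟨c', hc's, hc'le, hc'eq⟩ := ih N hNfree
    have hNA : ∀ x ∈ W, x ∉ N → x ∈ A := fun x hx hxN =>
      Finset.mem_filter.2 ⟨hx, fun h => hxN (Finset.mem_filter.2 ⟨hx, h⟩)⟩
    have hAN : ∀ x ∈ A, x ∉ N := fun x hx hxN =>
      (Finset.mem_filter.1 hx).2 (Finset.mem_filter.1 hxN).2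
    have hNW : N ⊆ W := Finset.filter_subset _ _
    have hAW : A ⊆ W := Finset.filter_subset _ _
    set c : V → ℕ := fun x => if x ∈ N then c' x else s with hcdef
    have hcN : ∀ x ∈ N, c x = c' x := fun x hx => by simp [hcdef, hx]
    have hcA : ∀ x ∈ A, c x = s := fun x hx => by simp [hcdef, hAN x hx]
    have hprod : classProd c (s + 1) W = classProd c' s N * A.card := by
      rw [classProd, Finset.prod_range_succ, classProd]
      congr 1
      · refine Finset.prod_congr rfl fun i hi => ?_
        congr 1
        ext x
        have hi' := Finset.mem_range.1 hi
        simp only [Finset.mem_filter]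
        constructor
        · rintro ⟨hx, hxi⟩
          by_cases hxN : x ∈ N
          · exact ⟨hxN, (hcN x hxN).symm.trans hxi⟩
          · have := hcA x (hNA x hx hxN)
            omega
        · rintro ⟨hx, hxi⟩
          exact ⟨hNW hx, (hcN x hx).trans hxi⟩
      · congr 1
        ext x
        simp only [Finset.mem_filter]
        constructor
        · rintro ⟨hx, hxi⟩
          by_cases hxN : x ∈ N
          · have h1 := hcN x hxN
            have h2 := hc's x hxN
            omega
          · exact hNA x hx hxN
        · intro hx
          exact ⟨hAW hx, hcA x hx⟩
    -- Every `(s+1)`-clique meets `A`, since `N` contains none. Hence the count is at most the sum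
    -- over `A` of clique degrees, each at most that of `v`.
    have hmeet : ∀ t ∈ C, 1 ≤ {u ∈ A | u ∈ t}.card := by
      intro t ht
      rw [Nat.one_le_iff_ne_zero, ← Nat.pos_iff_ne_zero, Finset.card_pos]
      by_contra hcon
      rw [Finset.not_nonempty_iff_eq_empty] at hcon
      have htN : t ∈ cliquesIn G (s + 1) N := by
        rw [mem_cliquesIn] at ht ⊢
        refine ⟨fun x hx => ?_, ht.2⟩
        by_contra hxN
        have : x ∈ A.filter (fun u => u ∈ t) := Finset.mem_filter.2 ⟨hNA x (ht.1 hx) hxN, hx⟩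
        rw [hcon] at this
        simp at this
      rw [hNfree] at htN
      simp at htN
    have hdouble : ∑ u ∈ A, {t ∈ C | u ∈ t}.card = ∑ t ∈ C, {u ∈ A | u ∈ t}.card :=
      Finset.sum_card_bipartiteAbove_eq_sum_card_bipartiteBelow (fun u t => u ∈ t)
    have hdv : {t ∈ C | v ∈ t}.card ≤ (cliquesIn G s N).card := by
      refine Finset.card_le_card_of_injOn (fun t => t.erase v) ?_ ?_
      · intro t ht
        have ht := Finset.mem_filter.1 (Finset.mem_coe.1 ht)
        have htC := mem_cliquesIn.1 ht.1
        refine mem_cliquesIn.2 ⟨fun x hx => ?_, htC.2.erase_of_mem ht.2⟩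
        rw [Finset.mem_erase] at hx
        exact Finset.mem_filter.2 ⟨htC.1 hx.2, htC.2.isClique ht.2 hx.2 hx.1.symm⟩
      · intro t ht t' ht' h
        have ht := Finset.mem_filter.1 (Finset.mem_coe.1 ht)
        have ht' := Finset.mem_filter.1 (Finset.mem_coe.1 ht')
        rw [← Finset.insert_erase ht.2, ← Finset.insert_erase ht'.2]
        exact congrArg _ h
    have h1 : C.card ≤ ∑ t ∈ C, {u ∈ A | u ∈ t}.card := by
      rw [Finset.card_eq_sum_ones]
      exact Finset.sum_le_sum hmeet
    have hdA : ∀ u ∈ A, {t ∈ C | u ∈ t}.card ≤ classProd c' s N := fun u hu =>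
      (hmax u (hAW hu)).trans (hdv.trans hc'le)
    have h2 : ∑ u ∈ A, {t ∈ C | u ∈ t}.card ≤ ∑ _u ∈ A, classProd c' s N :=
      Finset.sum_le_sum hdA
    have h3 : ∑ _u ∈ A, classProd c' s N = classProd c (s + 1) W := by
      rw [Finset.sum_const, smul_eq_mul, hprod, mul_comm]
    refine ⟨c, fun x hx => ?_, by omega, ?_⟩
    · by_cases hxN : x ∈ N
      · rw [hcN x hxN]
        have := hc's x hxN
        omega
      · rw [hcA x (hNA x hx hxN)]
        omega
    intro heq hne0
    have hP : classProd c' s N ≠ 0 := fun h => hne0 (by rw [hprod, h, zero_mul])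
    -- Equality makes every estimate tight: each clique meets `A` exactly once, and all vertices of
    -- `A` have the same maximal clique degree.
    have hone : ∀ t ∈ C, {u ∈ A | u ∈ t}.card = 1 := by
      have : ∑ _t ∈ C, 1 = ∑ t ∈ C, {u ∈ A | u ∈ t}.card := by
        rw [← Finset.card_eq_sum_ones]; omega
      intro t ht
      exact ((Finset.sum_eq_sum_iff_of_le hmeet).1 this t ht).symm
    have hdeg : ∀ u ∈ A, {t ∈ C | u ∈ t}.card = classProd c' s N :=
      (Finset.sum_eq_sum_iff_of_le hdA).1 (by omega)
    have hvA : v ∈ A := Finset.mem_filter.2 ⟨hvW, G.irrefl⟩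
    have hNcard : (cliquesIn G s N).card = classProd c' s N :=
      le_antisymm hc'le ((hdeg v hvA).symm.le.trans hdv)
    have hNadj := hc'eq hNcard hP
    -- Removing `u` sends the cliques through `u` injectively into the `s`-cliques of `N`. The two
    -- counts agree, so every `s`-clique of `N` arises.
    have hins : ∀ u ∈ A, ∀ T ∈ cliquesIn G s N, insert u T ∈ C := by
      intro u hu
      have hsub : {t ∈ C | u ∈ t}.image (fun t => t.erase u) ⊆ cliquesIn G s N := by
        intro T hT
        obtain ⟨t, ht, rfl⟩ := Finset.mem_image.1 hT
        rw [Finset.mem_filter] at ht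
        have htC := mem_cliquesIn.1 ht.1
        refine mem_cliquesIn.2 ⟨fun x hx => ?_, htC.2.erase_of_mem ht.2⟩
        rw [Finset.mem_erase] at hx
        by_contra hxN
        refine hx.1 (Finset.card_le_one.1 (hone t ht.1).le x ?_ u ?_)
        · exact Finset.mem_filter.2 ⟨hNA x (htC.1 hx.2) hxN, hx.2⟩
        · exact Finset.mem_filter.2 ⟨hu, ht.2⟩
      have hinj : Set.InjOn (fun t : Finset V => t.erase u) ({t ∈ C | u ∈ t} : Finset _) := by
        intro t ht t' ht' h
        have ht := Finset.mem_filter.1 (Finset.mem_coe.1 ht)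
        have ht' := Finset.mem_filter.1 (Finset.mem_coe.1 ht')
        rw [← Finset.insert_erase ht.2, ← Finset.insert_erase ht'.2]
        exact congrArg _ h
      have himg := Finset.eq_of_subset_of_card_le hsub
        (by rw [Finset.card_image_of_injOn hinj, hdeg u hu, hNcard])
      intro T hT
      rw [← himg] at hT
      obtain ⟨t, ht, rfl⟩ := Finset.mem_image.1 hT
      rw [Finset.mem_filter] at ht
      rw [Finset.insert_erase ht.2]
      exact ht.1
    -- Nonzero classes put each `w ∈ N` in an `s`-clique of `N`, which extends by `u`.
    have hcross : ∀ u ∈ A, ∀ w ∈ N, G.Adj u w := by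
      intro u hu w hw
      obtain ⟨T, hT, hwT⟩ := exists_mem_cliquesIn (G := G)
        (fun x hx y hy h => (hNadj x hx y hy).2 h) (exists_of_classProd_ne_zero hP) hw (hc's w hw)
      refine (mem_cliquesIn.1 (hins u hu T hT)).2.isClique (by simp) (by simp [hwT]) ?_
      rintro rfl
      exact hAN _ hu hw
    -- An edge inside `A` together with an `s`-clique of `N` would be an `(s+2)`-clique.
    have hindep : ∀ u ∈ A, ∀ u' ∈ A, ¬ G.Adj u u' := by
      intro u hu u' hu' hadj
      obtain ⟨T, hT⟩ := Finset.card_pos.1 (Nat.pos_of_ne_zero (hNcard ▸ hP))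
      have hin := mem_cliquesIn.1 (hins u' hu' T hT)
      have : insert u (insert u' T) ∈ cliquesIn G (s + 1 + 1) W := by
        refine mem_cliquesIn.2 ⟨Finset.insert_subset (hAW hu) hin.1, hin.2.insert fun b hb => ?_⟩
        rcases Finset.mem_insert.1 hb with rfl | hb
        · exact hadj
        · exact hcross u hu b ((mem_cliquesIn.1 hT).1 hb)
      rw [hW] at this
      simp at this
    intro x hx y hy
    by_cases hxN : x ∈ N <;> by_cases hyN : y ∈ N
    · rw [hcN x hxN, hcN y hyN]
      exact hNadj x hxN y hyN
    · have hyA := hNA y hy hyN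
      have := hc's x hxN
      rw [hcN x hxN, hcA y hyA]
      exact iff_of_true (hcross y hyA x hxN).symm (by omega)
    · have hxA := hNA x hx hxN
      have := hc's y hyN
      rw [hcA x hxA, hcN y hyN]
      exact iff_of_true (hcross x hxA y hyN) (by omega)
    · have hxA := hNA x hx hxN
      have hyA := hNA y hy hyN
      rw [hcA x hxA, hcA y hyA]
      exact iff_of_false (hindep x hxA y hyA) (by simp)

end CliquesIn

/-! ### Maximising the product of class sizes. -/

section BalancedColoring

variable {V : Type*} {s : ℕ} {W : Finset V}

/-- Among the colourings of `W` with `s` colours there is one maximising `classProd`. -/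
lemma exists_maximal_classProd (hs : 0 < s) (W : Finset V) :
    ∃ c : V → ℕ, (∀ v ∈ W, c v < s) ∧
      ∀ c' : V → ℕ, (∀ v ∈ W, c' v < s) → classProd c' s W ≤ classProd c s W := by
  set S : Set ℕ := {p | ∃ c : V → ℕ, (∀ v ∈ W, c v < s) ∧ classProd c s W = p} with hS
  have hne : S.Nonempty := ⟨_, fun _ => 0, fun _ _ => hs, rfl⟩
  have hbdd : BddAbove S := by
    refine ⟨W.card ^ s, ?_⟩
    rintro p ⟨c, -, rfl⟩
    have := Finset.prod_le_pow_card (Finset.range s) (fun i => (W.filter (fun v => c v = i)).card)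
      W.card (fun i _ => Finset.card_filter_le _ _)
    simpa [classProd] using this
  obtain ⟨c, hc, hcp⟩ := Nat.sSup_mem hne hbdd
  refine ⟨c, hc, fun c' hc' => ?_⟩
  rw [hcp]
  exact le_csSup hbdd ⟨c', hc', rfl⟩

/-- The colour classes of a maximising colouring are balanced. -/
lemma card_class_le_of_maximal {c : V → ℕ} (hc : ∀ v ∈ W, c v < s)
    (hmax : ∀ c' : V → ℕ, (∀ v ∈ W, c' v < s) → classProd c' s W ≤ classProd c s W)
    (h0 : classProd c s W ≠ 0) {i j : ℕ} (hi : i < s) (hj : j < s) :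
    (W.filter (fun v => c v = i)).card ≤ (W.filter (fun v => c v = j)).card + 1 := by
  classical
  by_contra! hlt
  have hij : i ≠ j := by rintro rfl; omega
  obtain ⟨x, hx⟩ : (W.filter (fun v => c v = i)).Nonempty := Finset.card_pos.1 (by omega)
  have hxW := (Finset.mem_filter.1 hx).1
  have hxi := (Finset.mem_filter.1 hx).2
  -- Moving `x` from class `i` to class `j` replaces the factor `a * b` by `(a - 1) * (b + 1)`,
  -- which is larger when `a ≥ b + 2`.
  set c' := Function.update c x j with hc'
  have hc's : ∀ v ∈ W, c' v < s := fun v hv => by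
    by_cases hvx : v = x
    · simpa [hc', hvx] using hj
    · simpa [hc', hvx] using hc v hv
  have hsplit : ∀ d : V → ℕ, classProd d s W =
      (W.filter (fun v => d v = i)).card * ((W.filter (fun v => d v = j)).card *
        ∏ k ∈ ((Finset.range s).erase i).erase j, (W.filter (fun v => d v = k)).card) := by
    intro d
    rw [Finset.mul_prod_erase _ (fun k => (W.filter (fun v => d v = k)).card)
        (Finset.mem_erase.2 ⟨hij.symm, Finset.mem_range.2 hj⟩),
      Finset.mul_prod_erase _ (fun k => (W.filter (fun v => d v = k)).card)
        (Finset.mem_range.2 hi), classProd]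
  have hrest : ∏ k ∈ ((Finset.range s).erase i).erase j, (W.filter (fun v => c' v = k)).card =
      ∏ k ∈ ((Finset.range s).erase i).erase j, (W.filter (fun v => c v = k)).card := by
    refine Finset.prod_congr rfl fun k hk => ?_
    simp only [Finset.mem_erase] at hk
    congr 1
    refine Finset.filter_congr fun v _ => ?_
    by_cases hvx : v = x
    · subst hvx
      simp only [hc', Function.update_self]
      exact iff_of_false (fun h => hk.1 h.symm) (fun h => hk.2.1 (h.symm.trans hxi))
    · simp [hc', hvx]
  have hfi : W.filter (fun v => c' v = i) = (W.filter (fun v => c v = i)).erase x := by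
    ext v
    simp only [Finset.mem_filter, Finset.mem_erase]
    by_cases hvx : v = x
    · simp [hc', hvx, hij.symm]
    · simp [hc', hvx]
  have hfj : W.filter (fun v => c' v = j) = insert x (W.filter (fun v => c v = j)) := by
    ext v
    simp only [Finset.mem_filter, Finset.mem_insert]
    by_cases hvx : v = x
    · simp [hc', hvx, hxW]
    · simp [hc', hvx]
  have hxj : x ∉ W.filter (fun v => c v = j) := fun h =>
    hij (hxi.symm.trans (Finset.mem_filter.1 h).2)
  have hle := hmax c' hc's
  rw [hsplit c', hsplit c, hrest, hfi, hfj, Finset.card_erase_of_mem hx,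
    Finset.card_insert_of_notMem hxj] at hle
  rw [hsplit c] at h0
  set R := ∏ k ∈ ((Finset.range s).erase i).erase j, (W.filter (fun v => c v = k)).card
  have hR : 0 < R := Nat.pos_of_ne_zero fun h => h0 (by rw [h]; simp)
  set a := (W.filter (fun v => c v = i)).card
  set b := (W.filter (fun v => c v = j)).card
  obtain ⟨d, hd⟩ : ∃ d, a = b + 2 + d := ⟨a - (b + 2), by omega⟩
  rw [hd, ← mul_assoc, ← mul_assoc] at hle
  have := Nat.le_of_mul_le_mul_right hle hR
  have h1 : b + 2 + d - 1 = b + 1 + d := by omega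
  rw [h1] at this
  nlinarith

/-- The elements of `W` can be enumerated so that the classes of a balanced colouring become the
residue classes modulo the number of colours. -/
lemma exists_equiv_fin_of_balanced {c : V → ℕ} (hc : ∀ v ∈ W, c v < s)
    (hpos : ∀ i < s, ∃ x ∈ W, c x = i)
    (hbal : ∀ i < s, ∀ j < s,
      (W.filter (fun v => c v = i)).card ≤ (W.filter (fun v => c v = j)).card + 1) :
    ∃ e : W ≃ Fin W.card, ∀ a b : W, c a = c b ↔ (e a : ℕ) % s = (e b : ℕ) % s := by
  classical
  let cls : ℕ → Finset V := fun i => W.filter (fun v => c v = i)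
  have hmem : ∀ {i x}, x ∈ cls i ↔ x ∈ W ∧ c x = i := by simp [cls]
  let P : Finpartition W := Finpartition.ofExistsUnique ((Finset.range s).image cls)
    (by
      intro p hp
      obtain ⟨i, -, rfl⟩ := Finset.mem_image.1 hp
      exact Finset.filter_subset _ _)
    (by
      intro a ha
      refine ⟨cls (c a), ⟨Finset.mem_image_of_mem _ (Finset.mem_range.2 (hc a ha)),
        hmem.2 ⟨ha, rfl⟩⟩, ?_⟩
      rintro t ⟨ht, hat⟩
      obtain ⟨i, -, rfl⟩ := Finset.mem_image.1 ht
      rw [(hmem.1 hat).2])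
    (by
      intro h
      obtain ⟨i, hi, h⟩ := Finset.mem_image.1 h
      obtain ⟨x, hx, hxi⟩ := hpos i (Finset.mem_range.1 hi)
      have := hmem.2 ⟨hx, hxi⟩
      rw [h] at this
      simp at this)
  have hparts : P.parts = (Finset.range s).image cls := rfl
  -- Nonempty classes are pairwise distinct as sets, so the modulus of the enumeration is exactly
  -- `s`.
  have hcard : P.parts.card = s := by
    rw [hparts, Finset.card_image_of_injOn, Finset.card_range]
    intro i hi j _ hij
    obtain ⟨x, hx, hxi⟩ := hpos i (Finset.mem_range.1 (Finset.mem_coe.1 hi))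
    have := hmem.2 ⟨hx, hxi⟩
    rw [show cls i = cls j from hij] at this
    exact hxi.symm.trans (hmem.1 this).2
  have heq : P.IsEquipartition := by
    intro p q hp hq
    rw [hparts] at hp hq
    obtain ⟨i, hi, rfl⟩ := Finset.mem_image.1 (Finset.mem_coe.1 hp)
    obtain ⟨j, hj, rfl⟩ := Finset.mem_image.1 (Finset.mem_coe.1 hq)
    exact hbal i (Finset.mem_range.1 hi) j (Finset.mem_range.1 hj)
  have hpart : ∀ a ∈ W, P.part a = cls (c a) := fun a ha =>
    P.part_eq_of_mem (hparts ▸ Finset.mem_image_of_mem _ (Finset.mem_range.2 (hc a ha)))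
      (hmem.2 ⟨ha, rfl⟩)
  obtain ⟨e, he⟩ := heq.exists_partPreservingEquiv
  refine ⟨e, fun a b => ?_⟩
  rw [hcard] at he
  rw [← he a b, hpart a a.2, hpart b b.2]
  refine ⟨fun h => by rw [h], fun h => ?_⟩
  have := hmem.2 ⟨a.2, rfl⟩
  rw [h] at this
  exact (hmem.1 this).2

/-- Some colouring with `s` colours has all classes of size at least `#W / s`. -/
lemma exists_pow_le_classProd (hs : 0 < s) (W : Finset V) :
    ∃ c : V → ℕ, (∀ v ∈ W, c v < s) ∧ (W.card / s) ^ s ≤ classProd c s W := by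
  classical
  let e := W.equivFin
  let c : V → ℕ := fun v => if h : v ∈ W then (e ⟨v, h⟩ : ℕ) % s else 0
  refine ⟨c, fun v hv => by simp only [c, dif_pos hv]; exact Nat.mod_lt _ hs, ?_⟩
  have hclass : ∀ i ∈ Finset.range s, W.card / s ≤ (W.filter (fun v => c v = i)).card := by
    intro i hi
    rw [Finset.mem_range] at hi
    -- The colours are indices modulo `s`; the indices `i + s * k` with `k < W.card / s` all lie in
    -- class `i`.
    have hlt : ∀ k : Fin (W.card / s), i + s * k < W.card := fun k => by
      have h1 : s * (k + 1) ≤ s * (W.card / s) := Nat.mul_le_mul_left s k.2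
      have h2 := Nat.mul_div_le W.card s
      rw [mul_add] at h1
      omega
    have hcf : ∀ k : Fin (W.card / s), c (e.symm ⟨i + s * k, hlt k⟩) = i := fun k => by
      simp [c, Nat.mod_eq_of_lt hi]
    have := Finset.card_le_card_of_injOn (s := (Finset.univ : Finset (Fin (W.card / s))))
      (t := W.filter (fun v => c v = i)) (fun k => (e.symm ⟨i + s * k, hlt k⟩ : V))
      (fun k _ => by simpa using hcf k)
      (fun k _ l _ h => by
        have h := e.symm.injective (Subtype.ext h)
        rw [Fin.mk.injEq] at h
        exact Fin.ext (Nat.eq_of_mul_eq_mul_left hs (by omega)))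
    simpa using this
  have := Finset.pow_card_le_prod (Finset.range s) _ _ hclass
  simpa [classProd] using this

end BalancedColoring

/-! ### Zykov's theorem with its equality case. -/

section Zykov

variable {V : Type*} {G : SimpleGraph V} {s : ℕ} {W : Finset V}

/-- The classes of a maximising colouring are the parts of a Turán graph. -/
lemma exists_equiv_turanGraph_of_maximal {c : V → ℕ} (hc : ∀ v ∈ W, c v < s)
    (hmax : ∀ c' : V → ℕ, (∀ v ∈ W, c' v < s) → classProd c' s W ≤ classProd c s W)
    (h0 : classProd c s W ≠ 0) :
    ∃ e : W ≃ Fin W.card, ∀ a b : W, (turanGraph W.card s).Adj (e a) (e b) ↔ c a ≠ c b := by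
  obtain ⟨e, he⟩ := exists_equiv_fin_of_balanced hc (exists_of_classProd_ne_zero h0)
    fun i hi j hj => card_class_le_of_maximal hc hmax h0 hi hj
  exact ⟨e, fun a b => by rw [turanGraph_adj, Ne, Ne, he]⟩

/-- A maximising colouring has balanced nonempty classes, so it is the Turán colouring after
relabelling, and its transversals are cliques there. -/
lemma classProd_le_card_cliquesIn_turanGraph (hs : 0 < s) (hsW : s ≤ W.card) {c : V → ℕ}
    (hc : ∀ v ∈ W, c v < s) :
    classProd c s W ≤ (cliquesIn (turanGraph W.card s) s Finset.univ).card := by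
  obtain ⟨d, hd, hmax⟩ := exists_maximal_classProd hs W
  obtain ⟨b, hb, hpow⟩ := exists_pow_le_classProd hs W
  have h0 : classProd d s W ≠ 0 := by
    have h1 : 0 < (W.card / s) ^ s := pow_pos (Nat.div_pos hsW hs) s
    have := hmax b hb
    omega
  obtain ⟨e, he⟩ := exists_equiv_turanGraph_of_maximal hd hmax h0
  refine (hmax c hc).trans ?_
  have hcp : classProd d s W = classProd (fun x => d (e.symm x)) s Finset.univ := by
    refine Finset.prod_congr rfl fun i _ => ?_
    symm
    refine Finset.card_bij (fun x _ => (e.symm x : V)) ?_ ?_ ?_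
    · intro x hx
      exact Finset.mem_filter.2 ⟨(e.symm x).2, (Finset.mem_filter.1 hx).2⟩
    · intro x _ y _ h
      exact e.symm.injective (Subtype.ext h)
    · intro v hv
      rw [Finset.mem_filter] at hv
      exact ⟨e ⟨v, hv.1⟩, by simp [hv.2], by simp⟩
  rw [hcp]
  refine classProd_le_card_cliquesIn fun x _ y _ h => ?_
  have := (he (e.symm x) (e.symm y)).2 h
  simpa using this

lemma pow_le_card_cliquesIn_turanGraph (hs : 0 < s) {m : ℕ} (hsm : s ≤ m) :
    (m / s) ^ s ≤ (cliquesIn (turanGraph m s) s Finset.univ).card := by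
  obtain ⟨b, hb, hpow⟩ := exists_pow_le_classProd hs (Finset.univ : Finset (Fin m))
  have := classProd_le_card_cliquesIn_turanGraph hs (by simpa using hsm) hb
  rw [Finset.card_univ, Fintype.card_fin] at hpow this
  exact hpow.trans this

/-- **Zykov's theorem** for cliques of the largest size: a set of `m` vertices without
`(s + 1)`-clique contains at most as many `s`-cliques as `turanGraph m s`, with equality only for
the Turán graph. -/
theorem card_cliquesIn_le_turanGraph (hs : 0 < s) {m : ℕ} (hm : W.card = m) (hsm : s ≤ m)
    (hW : cliquesIn G (s + 1) W = ∅) :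
    (cliquesIn G s W).card ≤ (cliquesIn (turanGraph m s) s Finset.univ).card ∧
      ((cliquesIn G s W).card = (cliquesIn (turanGraph m s) s Finset.univ).card →
        ∃ e : W ≃ Fin m, ∀ a b : W, G.Adj a b ↔ (turanGraph m s).Adj (e a) (e b)) := by
  subst hm
  obtain ⟨c, hc, hle, heq⟩ := exists_coloring_card_cliquesIn_le G s W hW
  have hcT := classProd_le_card_cliquesIn_turanGraph hs hsm hc
  refine ⟨hle.trans hcT, fun h => ?_⟩
  have h0 : classProd c s W ≠ 0 := by
    have h1 : 0 < (W.card / s) ^ s := pow_pos (Nat.div_pos hsm hs) s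
    have := pow_le_card_cliquesIn_turanGraph hs hsm
    omega
  -- Equality of the clique counts squeezes `classProd c s W` up to the Turán value, so `c` is
  -- itself a maximiser.
  obtain ⟨e, he⟩ := exists_equiv_turanGraph_of_maximal hc (fun c' hc' => by
    have := classProd_le_card_cliquesIn_turanGraph hs hsm hc'
    omega) h0
  exact ⟨e, fun a b => by rw [he, heq (by omega) h0 a a.2 b b.2]⟩

end Zykov

/-! ### Intersecting families without a common element. -/

section Intersecting

/-- An intersecting family of `r`-sets without a common element has at most `r² n^(r-2)` members. -/
theorem card_le_of_intersecting {V : Type*} [Fintype V] {r : ℕ} {F : Finset (Finset V)}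
    (hcard : ∀ t ∈ F, t.card = r) (hint : ∀ t ∈ F, ∀ t' ∈ F, ¬ Disjoint t t')
    (hno : ∀ v : V, ∃ t ∈ F, v ∉ t) : F.card ≤ r * (r * Fintype.card V ^ (r - 2)) := by
  classical
  rcases F.eq_empty_or_nonempty with rfl | ⟨A, hA⟩
  · simp
  choose B hBF hB using hno
  -- Each member meets `A` in some `x`, and meets `B x`, which avoids `x`, in some `y ≠ x`. So at
  -- most `r * r` pairs cover the family.
  have hsub : F ⊆ A.biUnion fun x => (B x).biUnion fun y => F.filter fun t => x ∈ t ∧ y ∈ t := by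
    intro t ht
    obtain ⟨x, hxt, hxA⟩ := Finset.not_disjoint_iff.1 (hint t ht A hA)
    obtain ⟨y, hyt, hyB⟩ := Finset.not_disjoint_iff.1 (hint t ht (B x) (hBF x))
    simp only [Finset.mem_biUnion, Finset.mem_filter]
    exact ⟨x, hxA, y, hyB, ht, hxt, hyt⟩
  have hpair : ∀ x y, x ≠ y →
      (F.filter fun t => x ∈ t ∧ y ∈ t).card ≤ Fintype.card V ^ (r - 2) := by
    intro x y hxy
    have hle : (F.filter fun t => x ∈ t ∧ y ∈ t).card ≤
        ((Finset.univ : Finset V).powersetCard (r - 2)).card := by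
      have hins : ∀ t : Finset V, x ∈ t ∧ y ∈ t → insert x (insert y ((t.erase x).erase y)) = t :=
        fun t ht => by
          rw [Finset.insert_erase (Finset.mem_erase.2 ⟨hxy.symm, ht.2⟩), Finset.insert_erase ht.1]
      refine Finset.card_le_card_of_injOn (fun t => (t.erase x).erase y) ?_ ?_
      · intro t ht
        have ht := Finset.mem_filter.1 (Finset.mem_coe.1 ht)
        refine Finset.mem_coe.2 (Finset.mem_powersetCard.2 ⟨Finset.subset_univ _, ?_⟩)
        rw [Finset.card_erase_of_mem (Finset.mem_erase.2 ⟨hxy.symm, ht.2.2⟩),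
          Finset.card_erase_of_mem ht.2.1, hcard t ht.1]
        omega
      · intro t ht t' ht' h
        rw [← hins t (Finset.mem_filter.1 (Finset.mem_coe.1 ht)).2,
          ← hins t' (Finset.mem_filter.1 (Finset.mem_coe.1 ht')).2]
        exact congrArg (fun u => insert x (insert y u)) h
    refine hle.trans ?_
    rw [Finset.card_powersetCard, Finset.card_univ]
    exact Nat.choose_le_pow _ _
  refine (Finset.card_le_card hsub).trans ?_
  refine (Finset.card_biUnion_le_card_mul _ _ (r * Fintype.card V ^ (r - 2)) fun x _ => ?_).trans
    (by rw [hcard A hA])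
  refine (Finset.card_biUnion_le_card_mul _ _ (Fintype.card V ^ (r - 2)) fun y hy => ?_).trans
    (by rw [hcard _ (hBF x)])
  exact hpair x y fun h => hB x (h ▸ hy)

end Intersecting

/-! ### Copies of complete graphs as cliques. -/

section Counting

variable {V : Type*} [Fintype V] {G : SimpleGraph V}

theorem copyCount_completeGraph (G : SimpleGraph V) (r : ℕ) :
    G.copyCount (completeGraph (Fin r)) = (cliquesIn G r Finset.univ).card := by
  classical
  rw [copyCount]
  symm
  refine Finset.card_bij (fun t _ => (⊤ : G.Subgraph).induce (t : Set V)) ?_ ?_ ?_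
  · intro t ht
    have ht := (mem_cliquesIn.1 ht).2
    rw [Finset.mem_filter]
    refine ⟨Finset.mem_univ _, ⟨⟨(t.equivFinOfCardEq ht.card_eq).symm, ?_⟩⟩⟩
    intro a b
    set x := (t.equivFinOfCardEq ht.card_eq).symm a with hx
    set y := (t.equivFinOfCardEq ht.card_eq).symm b with hy
    have hxy : x = y ↔ a = b := by rw [hx, hy, EmbeddingLike.apply_eq_iff_eq]
    simp only [Subgraph.coe_adj, Subgraph.induce_adj, Subgraph.top_adj, completeGraph, top_adj]
    constructor
    · rintro h hab
      exact h.2.2.ne (congrArg Subtype.val (hxy.2 hab))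
    · intro hab
      exact ⟨x.2, y.2, ht.isClique x.2 y.2 fun h => hab (hxy.1 (Subtype.ext h))⟩
  · intro t _ t' _ h
    have := congrArg Subgraph.verts h
    simpa using this
  · intro H hH
    obtain ⟨e⟩ := (Finset.mem_filter.1 hH).2
    have hadj : ∀ x ∈ H.verts, ∀ y ∈ H.verts, x ≠ y → H.Adj x y := by
      intro x hx y hy hxy
      have : H.coe.Adj ⟨x, hx⟩ ⟨y, hy⟩ := by
        rw [← e.symm.map_adj_iff]
        exact fun h => hxy (congrArg Subtype.val (e.symm.injective h))
      exact this
    -- A complete subgraph is induced by its vertex set, so each copy comes from its clique.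
    refine ⟨H.verts.toFinset, mem_cliquesIn.2 ⟨Finset.subset_univ _, ?_, ?_⟩, ?_⟩
    · intro x hx y hy hxy
      simp only [Set.coe_toFinset] at hx hy
      exact (hadj x hx y hy hxy).adj_sub
    · rw [Set.toFinset_card, ← Fintype.card_congr e.toEquiv, Fintype.card_fin]
    · ext x y
      · simp
      · simp only [Subgraph.induce_adj, Set.coe_toFinset, Subgraph.top_adj]
        exact ⟨fun h => hadj x h.1 y h.2.1 h.2.2.ne,
          fun h => ⟨h.fst_mem, h.snd_mem, h.adj_sub⟩⟩

lemma card_cliquesIn_le_of_iso {V' : Type*} [Fintype V'] {G' : SimpleGraph V'} (e : G ≃g G')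
    (r : ℕ) : (cliquesIn G r Finset.univ).card ≤ (cliquesIn G' r Finset.univ).card := by
  refine Finset.card_le_card_of_injOn (fun t => t.map e.toEquiv.toEmbedding) ?_
    fun t _ t' _ h => Finset.map_injective _ h
  intro t ht
  have ht := (mem_cliquesIn.1 (Finset.mem_coe.1 ht)).2
  refine Finset.mem_coe.2 (mem_cliquesIn.2 ⟨Finset.subset_univ _, ?_, ?_⟩)
  · intro x hx y hy hxy
    obtain ⟨a, ha, rfl⟩ := Finset.mem_map.1 (Finset.mem_coe.1 hx)
    obtain ⟨b, hb, rfl⟩ := Finset.mem_map.1 (Finset.mem_coe.1 hy)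
    exact e.map_adj_iff.2 (ht.isClique ha hb fun h => hxy (by rw [h]))
  · rw [Finset.card_map, ht.card_eq]

lemma card_cliquesIn_congr {V' : Type*} [Fintype V'] {G' : SimpleGraph V'} (e : G ≃g G') (r : ℕ) :
    (cliquesIn G r Finset.univ).card = (cliquesIn G' r Finset.univ).card :=
  le_antisymm (card_cliquesIn_le_of_iso e r) (card_cliquesIn_le_of_iso e.symm r)

theorem twoDisjointCliques_free_iff (r : ℕ) :
    (twoDisjointCliques r).Free G ↔
      ∀ t ∈ cliquesIn G r Finset.univ, ∀ t' ∈ cliquesIn G r Finset.univ, ¬ Disjoint t t' := by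
  classical
  constructor
  · intro hfree t ht t' ht' hdisj
    have ht := (mem_cliquesIn.1 ht).2
    have ht' := (mem_cliquesIn.1 ht').2
    let a := (t.equivFinOfCardEq ht.card_eq).symm
    let b := (t'.equivFinOfCardEq ht'.card_eq).symm
    have hab : ∀ i j, (a i : V) ≠ b j := fun i j h =>
      Finset.disjoint_left.1 hdisj (a i).2 (h ▸ (b j).2)
    refine hfree ⟨⟨⟨Sum.elim (fun i => (a i : V)) (fun j => (b j : V)), ?_⟩, ?_⟩⟩
    · rintro (i | i) (j | j) hij
      · have hij : i ≠ j := by simpa [twoDisjointCliques, completeGraph] using hij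
        exact ht.isClique (a i).2 (a j).2 fun h => hij (a.injective (Subtype.ext h))
      · simp [twoDisjointCliques] at hij
      · simp [twoDisjointCliques] at hij
      · have hij : i ≠ j := by simpa [twoDisjointCliques, completeGraph] using hij
        exact ht'.isClique (b i).2 (b j).2 fun h => hij (b.injective (Subtype.ext h))
    · rintro (i | i) (j | j) hij
      · exact congrArg Sum.inl (a.injective (Subtype.ext hij))
      · exact absurd hij (hab i j)
      · exact absurd hij.symm (hab j i)
      · exact congrArg Sum.inr (b.injective (Subtype.ext hij))
  · rintro h ⟨f⟩
    have hclique : ∀ g : Fin r → Fin r ⊕ Fin r, Function.Injective g →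
        (∀ i j, i ≠ j → (twoDisjointCliques r).Adj (g i) (g j)) →
        Finset.univ.image (fun i => f (g i)) ∈ cliquesIn G r Finset.univ := by
      intro g hg hadj
      refine mem_cliquesIn.2 ⟨Finset.subset_univ _, ?_, ?_⟩
      · intro x hx y hy hxy
        obtain ⟨i, -, rfl⟩ := Finset.mem_image.1 (Finset.mem_coe.1 hx)
        obtain ⟨j, -, rfl⟩ := Finset.mem_image.1 (Finset.mem_coe.1 hy)
        exact f.toHom.map_adj (hadj i j fun h => hxy (by rw [h]))
      · rw [Finset.card_image_of_injective _ (f := fun i => f (g i))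
          fun i j hij => hg (f.injective hij), Finset.card_univ, Fintype.card_fin]
    refine h _ (hclique Sum.inl Sum.inl_injective ?_) _ (hclique Sum.inr Sum.inr_injective ?_) ?_
    · intro i j hij
      simpa [twoDisjointCliques, completeGraph] using hij
    · intro i j hij
      simpa [twoDisjointCliques, completeGraph] using hij
    · rw [Finset.disjoint_left]
      intro x hx hx'
      obtain ⟨i, -, rfl⟩ := Finset.mem_image.1 hx
      obtain ⟨j, -, hj⟩ := Finset.mem_image.1 hx'
      exact Sum.inr_ne_inl (f.injective hj)

end Counting

/-! ### All cliques through one vertex. -/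

section Hub

variable {V : Type*} [Fintype V] {G : SimpleGraph V} {s m : ℕ}

lemma nonempty_iso_graphJoin [DecidableEq V] {T : SimpleGraph (Fin m)} {v : V}
    (hv : ∀ x, x ≠ v → G.Adj v x) (e : (Finset.univ.erase v : Finset V) ≃ Fin m)
    (he : ∀ a b : (Finset.univ.erase v : Finset V), G.Adj a b ↔ T.Adj (e a) (e b)) :
    Nonempty (G ≃g graphJoin (completeGraph (Fin 1)) T) := by
  let f : Fin 1 ⊕ Fin m → V := Sum.elim (fun _ => v) (fun i => (e.symm i : V))
  have hne : ∀ i, (e.symm i : V) ≠ v := fun i => (Finset.mem_erase.1 (e.symm i).2).1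
  have hbij : Function.Bijective f := by
    constructor
    · rintro (i | i) (j | j) h
      · exact congrArg Sum.inl (Subsingleton.elim i j)
      · exact absurd h.symm (hne j)
      · exact absurd h (hne i)
      · exact congrArg Sum.inr (e.symm.injective (Subtype.ext h))
    · intro x
      by_cases hx : x = v
      · exact ⟨Sum.inl 0, hx.symm⟩
      · exact ⟨Sum.inr (e ⟨x, Finset.mem_erase.2 ⟨hx, Finset.mem_univ x⟩⟩), by simp [f]⟩
  refine ⟨Iso.symm ⟨Equiv.ofBijective f hbij, ?_⟩⟩
  rintro (i | i) (j | j)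
  · simp [f, graphJoin, completeGraph, Subsingleton.elim i j]
  · simpa [f, graphJoin] using hv _ (hne j)
  · simpa [f, graphJoin] using (hv _ (hne i)).symm
  · simp [f, graphJoin, he]

/-- If all `(s + 1)`-cliques share a vertex, their number is at most the number of `s`-cliques of
the Turán graph on the remaining vertices, with equality only for `K₁ ∨ T`. -/
theorem card_cliquesIn_le_of_forall_mem (hs : 0 < s) (hsm : s ≤ m) (hV : Fintype.card V = m + 1)
    {v : V} (hv : ∀ t ∈ cliquesIn G (s + 1) Finset.univ, v ∈ t) :
    (cliquesIn G (s + 1) Finset.univ).card ≤ (cliquesIn (turanGraph m s) s Finset.univ).card ∧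
      ((cliquesIn G (s + 1) Finset.univ).card = (cliquesIn (turanGraph m s) s Finset.univ).card →
        Nonempty (G ≃g graphJoin (completeGraph (Fin 1)) (turanGraph m s))) := by
  classical
  set W : Finset V := Finset.univ.erase v with hWdef
  have hWcard : W.card = m := by
    rw [hWdef, Finset.card_erase_of_mem (Finset.mem_univ v), Finset.card_univ, hV,
      Nat.add_sub_cancel]
  have hW : cliquesIn G (s + 1) W = ∅ := by
    refine Finset.eq_empty_of_forall_notMem fun t ht => ?_
    rw [mem_cliquesIn] at ht
    have := ht.1 (hv t (mem_cliquesIn.2 ⟨Finset.subset_univ _, ht.2⟩))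
    simp [hWdef] at this
  obtain ⟨hle, heq⟩ := card_cliquesIn_le_turanGraph hs hWcard hsm hW
  have hsub : (cliquesIn G (s + 1) Finset.univ).image (fun t => t.erase v) ⊆ cliquesIn G s W := by
    intro T hT
    obtain ⟨t, ht, rfl⟩ := Finset.mem_image.1 hT
    exact mem_cliquesIn.2 ⟨Finset.erase_subset_erase _ (Finset.subset_univ _),
      (mem_cliquesIn.1 ht).2.erase_of_mem (hv t ht)⟩
  have hinj : Set.InjOn (fun t : Finset V => t.erase v) (cliquesIn G (s + 1) Finset.univ) := by
    intro t ht t' ht' h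
    rw [← Finset.insert_erase (hv t ht), ← Finset.insert_erase (hv t' ht')]
    exact congrArg _ h
  have hcard := Finset.card_image_of_injOn hinj
  have hcle := Finset.card_le_card hsub
  refine ⟨by omega, fun h => ?_⟩
  -- In the equality case every `s`-clique of `W` extends by `v`. Since `s ≤ m`, all Turán classes
  -- are nonempty, so each `x ∈ W` lies in such a clique.
  have himg := Finset.eq_of_subset_of_card_le hsub (by omega)
  obtain ⟨e, he⟩ := heq (by omega)
  refine nonempty_iso_graphJoin (fun x hx => ?_) e he
  have hxW : x ∈ W := Finset.mem_erase.2 ⟨hx, Finset.mem_univ x⟩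
  let c : V → ℕ := fun y => if h : y ∈ W then (e ⟨y, h⟩ : ℕ) % s else 0
  have hcW : ∀ y (h : y ∈ W), c y = (e ⟨y, h⟩ : ℕ) % s := fun y h => dif_pos h
  obtain ⟨T, hT, hxT⟩ := exists_mem_cliquesIn (G := G) (s := s) (W := W) (c := c)
    (fun y hy z hz hyz => by
      rw [hcW y hy, hcW z hz] at hyz
      exact (he ⟨y, hy⟩ ⟨z, hz⟩).2 (turanGraph_adj.2 hyz))
    (fun i hi => ⟨e.symm ⟨i, hi.trans_le hsm⟩, (e.symm _).2, by
      rw [hcW _ (e.symm _).2]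
      simp [Nat.mod_eq_of_lt hi]⟩)
    hxW (by rw [hcW x hxW]; exact Nat.mod_lt _ hs)
  rw [← himg] at hT
  obtain ⟨t, ht, rfl⟩ := Finset.mem_image.1 hT
  exact (mem_cliquesIn.1 ht).2.isClique (hv t ht) (Finset.mem_of_mem_erase hxT) hx.symm

/-- A clique avoiding the hub would lie in the Turán graph, which has no `(s+1)`-clique. -/
lemma inl_mem_of_mem_cliquesIn_graphJoin (hs : 0 < s) {t : Finset (Fin 1 ⊕ Fin m)}
    (ht : t ∈ cliquesIn (graphJoin (completeGraph (Fin 1)) (turanGraph m s)) (s + 1)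
      Finset.univ) : Sum.inl 0 ∈ t := by
  classical
  by_contra h0
  have ht := (mem_cliquesIn.1 ht).2
  have hall : ∀ x ∈ t, x ∈ Set.range (Sum.inr : Fin m → Fin 1 ⊕ Fin m) := by
    rintro (i | i) hi
    · exact absurd (Subsingleton.elim i 0 ▸ hi) h0
    · exact ⟨i, rfl⟩
  refine turanGraph_cliqueFree (n := m) hs
    (t.preimage Sum.inr Sum.inr_injective.injOn) ⟨?_, ?_⟩
  · intro x hx y hy hxy
    have := ht.isClique (Finset.mem_preimage.1 (Finset.mem_coe.1 hx))
      (Finset.mem_preimage.1 (Finset.mem_coe.1 hy)) (fun h => hxy (Sum.inr_injective h))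
    simpa [graphJoin] using this
  · rw [← ht.card_eq, ← Finset.card_image_of_injective _ (Sum.inr_injective (α := Fin 1)),
      Finset.image_preimage, Finset.filter_true_of_mem hall]

/-- The hub bound gives one inequality; adding the hub to each `s`-clique of the Turán graph gives
the other. -/
theorem card_cliquesIn_graphJoin (hs : 0 < s) (hsm : s ≤ m) :
    (cliquesIn (graphJoin (completeGraph (Fin 1)) (turanGraph m s)) (s + 1) Finset.univ).card =
      (cliquesIn (turanGraph m s) s Finset.univ).card := by
  classical
  refine le_antisymm (card_cliquesIn_le_of_forall_mem hs hsm (by simp [add_comm])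
    (v := Sum.inl 0) fun t ht => inl_mem_of_mem_cliquesIn_graphJoin hs ht).1 ?_
  have hnot : ∀ t : Finset (Fin m),
      (Sum.inl 0 : Fin 1 ⊕ Fin m) ∉ t.map ⟨Sum.inr, Sum.inr_injective⟩ := fun t => by simp
  refine Finset.card_le_card_of_injOn
    (fun t => insert (Sum.inl 0) (t.map ⟨Sum.inr, Sum.inr_injective⟩)) ?_ ?_
  · intro t ht
    have ht := (mem_cliquesIn.1 (Finset.mem_coe.1 ht)).2
    refine Finset.mem_coe.2 (mem_cliquesIn.2 ⟨Finset.subset_univ _, IsNClique.insert ⟨?_, ?_⟩ ?_⟩)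
    · intro x hx y hy hxy
      obtain ⟨a, ha, rfl⟩ := Finset.mem_map.1 (Finset.mem_coe.1 hx)
      obtain ⟨b, hb, rfl⟩ := Finset.mem_map.1 (Finset.mem_coe.1 hy)
      have := ht.isClique ha hb fun h => hxy (by rw [h])
      simpa [graphJoin] using this
    · rw [Finset.card_map, ht.card_eq]
    · intro b hb
      obtain ⟨a, ha, rfl⟩ := Finset.mem_map.1 hb
      simp [graphJoin]
  · intro t _ t' _ h
    have h := congrArg (fun u => u.erase (Sum.inl 0)) h
    simp only [Finset.erase_insert (hnot _)] at h
    exact Finset.map_injective _ h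

theorem twoDisjointCliques_free_graphJoin (hs : 0 < s) :
    (twoDisjointCliques (s + 1)).Free (graphJoin (completeGraph (Fin 1)) (turanGraph m s)) :=
  (twoDisjointCliques_free_iff _).2 fun _ ht _ ht' hdisj => Finset.disjoint_left.1 hdisj
    (inl_mem_of_mem_cliquesIn_graphJoin hs ht) (inl_mem_of_mem_cliquesIn_graphJoin hs ht')

end Hub

/-! ### Comparison of the two cases for large `n`. -/

section Main

/-- The number of `s`-cliques of the Turán graph eventually exceeds any multiple of
`(m + 1)^(s - 1)`. -/
lemma mul_pow_lt_card_cliquesIn_turanGraph {s : ℕ} (hs : 0 < s) (K : ℕ) {m : ℕ}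
    (hm : s * (K * (2 * s) ^ (s - 1) + 1) ≤ m) :
    K * (m + 1) ^ (s - 1) < (cliquesIn (turanGraph m s) s Finset.univ).card := by
  have hsm : s ≤ m := (Nat.le_mul_of_pos_right s (Nat.succ_pos _)).trans hm
  refine lt_of_lt_of_le ?_ (pow_le_card_cliquesIn_turanGraph hs hsm)
  set q := m / s with hq
  have hqK : K * (2 * s) ^ (s - 1) + 1 ≤ q := by
    rw [hq, Nat.le_div_iff_mul_le hs, mul_comm]
    exact hm
  -- From `m + 1 ≤ s * (q + 1)` and `q ≥ 1`. The threshold on `m` is chosen so that `q` exceeds the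
  -- resulting constant `K * (2 * s) ^ (s - 1)`.
  have hmq : m + 1 ≤ 2 * s * q := by
    have h1 := Nat.lt_mul_div_succ m hs
    rw [← hq] at h1
    have h2 : s * 1 ≤ s * q := Nat.mul_le_mul_left s (by omega)
    nlinarith
  calc K * (m + 1) ^ (s - 1) ≤ K * (2 * s * q) ^ (s - 1) :=
        Nat.mul_le_mul_left _ (Nat.pow_le_pow_left hmq _)
    _ = (K * (2 * s) ^ (s - 1)) * q ^ (s - 1) := by rw [mul_pow, mul_assoc]
    _ < q * q ^ (s - 1) := Nat.mul_lt_mul_of_pos_right (by omega) (pow_pos (by omega) _)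
    _ = q ^ s := by rw [← pow_succ', Nat.sub_add_cancel hs]

/-- The extremal result for graphs on `m + 1` vertices. -/
theorem card_cliquesIn_le_of_free {V : Type*} [Fintype V] {G : SimpleGraph V} {s m : ℕ}
    (hs : 0 < s) (hV : Fintype.card V = m + 1)
    (hm : s * ((s + 1) * (s + 1) * (2 * s) ^ (s - 1) + 1) ≤ m)
    (hG : (twoDisjointCliques (s + 1)).Free G) :
    (cliquesIn G (s + 1) Finset.univ).card ≤ (cliquesIn (turanGraph m s) s Finset.univ).card ∧
      ((cliquesIn G (s + 1) Finset.univ).card = (cliquesIn (turanGraph m s) s Finset.univ).card →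
        Nonempty (G ≃g graphJoin (completeGraph (Fin 1)) (turanGraph m s))) := by
  have hsm : s ≤ m := (Nat.le_mul_of_pos_right s (Nat.succ_pos _)).trans hm
  by_cases hv : ∃ v, ∀ t ∈ cliquesIn G (s + 1) Finset.univ, v ∈ t
  · obtain ⟨v, hv⟩ := hv
    exact card_cliquesIn_le_of_forall_mem hs hsm hV hv
  · push Not at hv
    have h1 := card_le_of_intersecting (fun t ht => (mem_cliquesIn.1 ht).2.card_eq)
      ((twoDisjointCliques_free_iff _).1 hG) hv
    have h2 := mul_pow_lt_card_cliquesIn_turanGraph hs ((s + 1) * (s + 1)) hm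
    rw [hV, ← mul_assoc, show s + 1 - 2 = s - 1 by omega] at h1
    exact ⟨(h1.trans_lt h2).le, fun h => absurd h (h1.trans_lt h2).ne⟩

end Main

theorem theorem1p5 (r : ℕ) (hr : 3 ≤ r) :
    ∃ n₀ : ℕ, ∀ n : ℕ, n₀ ≤ n →
      generalizedTuranNumber n (completeGraph (Fin r)) (twoDisjointCliques r) =
          (turanGraph (n - 1) (r - 1)).copyCount (completeGraph (Fin (r - 1))) ∧
      ∀ G : SimpleGraph (Fin n),
        ((twoDisjointCliques r).Free G ∧
            G.copyCount (completeGraph (Fin r)) =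
              generalizedTuranNumber n (completeGraph (Fin r)) (twoDisjointCliques r)) ↔
          Nonempty (G ≃g graphJoin (completeGraph (Fin 1)) (turanGraph (n - 1) (r - 1))) := by
  obtain ⟨s, rfl⟩ : ∃ s, r = s + 1 := ⟨r - 1, by omega⟩
  have hs : 0 < s := by omega
  -- The growth threshold with `K = r²`, plus one for the hub.
  refine ⟨s * ((s + 1) * (s + 1) * (2 * s) ^ (s - 1) + 1) + 1, fun n hn => ?_⟩
  obtain ⟨m, rfl⟩ : ∃ m, n = m + 1 := ⟨n - 1, by omega⟩
  rw [Nat.add_sub_cancel, Nat.add_sub_cancel]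
  have hm := Nat.le_of_succ_le_succ hn
  have hsm : s ≤ m := (Nat.le_mul_of_pos_right s (Nat.succ_pos _)).trans hm
  have hiso : ∀ G : SimpleGraph (Fin (m + 1)),
      Nonempty (G ≃g graphJoin (completeGraph (Fin 1)) (turanGraph m s)) →
      (twoDisjointCliques (s + 1)).Free G ∧ G.copyCount (completeGraph (Fin (s + 1))) =
        (turanGraph m s).copyCount (completeGraph (Fin s)) := by
    rintro G ⟨e⟩
    refine ⟨(free_congr_right e).2 (twoDisjointCliques_free_graphJoin hs), ?_⟩
    rw [copyCount_completeGraph, copyCount_completeGraph, card_cliquesIn_congr e,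
      card_cliquesIn_graphJoin hs hsm]
  have hbound : ∀ G : SimpleGraph (Fin (m + 1)), (twoDisjointCliques (s + 1)).Free G →
      G.copyCount (completeGraph (Fin (s + 1))) ≤
        (turanGraph m s).copyCount (completeGraph (Fin s)) ∧
      (G.copyCount (completeGraph (Fin (s + 1))) =
          (turanGraph m s).copyCount (completeGraph (Fin s)) →
        Nonempty (G ≃g graphJoin (completeGraph (Fin 1)) (turanGraph m s))) := by
    intro G hG
    rw [copyCount_completeGraph, copyCount_completeGraph]
    exact card_cliquesIn_le_of_free hs (Fintype.card_fin _) hm hG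
  have hmax : generalizedTuranNumber (m + 1) (completeGraph (Fin (s + 1)))
      (twoDisjointCliques (s + 1)) = (turanGraph m s).copyCount (completeGraph (Fin s)) := by
    classical
    refine le_antisymm (Finset.sup_le fun G hG => (hbound G (Finset.mem_filter.1 hG).2).1) ?_
    let e : Fin (m + 1) ≃ Fin 1 ⊕ Fin m := (finCongr (add_comm m 1)).trans finSumFinEquiv.symm
    -- The supremum ranges over graphs on `Fin (m + 1)`, so the join is transported there to witness
    -- the lower bound.
    let J := (graphJoin (completeGraph (Fin 1)) (turanGraph m s)).comap e
    obtain ⟨hJ, hJcount⟩ := hiso J ⟨Iso.comap e _⟩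
    rw [← hJcount]
    exact Finset.le_sup (f := fun G : SimpleGraph (Fin (m + 1)) =>
      G.copyCount (completeGraph (Fin (s + 1)))) (Finset.mem_filter.2 ⟨Finset.mem_univ J, hJ⟩)
  rw [hmax]
  exact ⟨rfl, fun G => ⟨fun h => (hbound G h.1).2 h.2, hiso G⟩⟩
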